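/- **Setting.** Consider the dependent type theory whose $\beta$-normal terms, taken up to renaming of bound variables, are $A,B,t,u ::= \mathsf{Set}\mid\mathsf{Bool}\mid\mathsf{true}\mid\mathsf{false}\mid (x:A)\to B\mid \lambda x\to t\mid n$, with neutral terms $n ::= x\mid\alpha\mid n\,t\mid \mathbf{if}\ n/x.A\ \mathbf{then}\ t\ \mathbf{else}\ u$, where $x$ is a variable and $\alpha$ a meta-variable. A context $\Gamma$ lists types of variables, and a signature $\Sigma$ lists closed types of meta-variables. Substitution $t[x:=u]$ and the eliminations $t\,u$ and $\mathbf{if}\ t/x.A\ \mathbf{then}\ u\ \mathbf{else}\ v$ are hereditary: $(\lambda x\to t)\,u$ evaluates to $t[x:=u]$, an $\mathbf{if}$ on $\mathsf{true}$ or $\mathsf{false}$ evaluates to the corresponding branch, and eliminations of neutral terms are neutral. They are partial operations, and a rule that mentions one requires it to be defined. Heads: $\Gamma\vdash h\Rightarrow A$ if $h:A$ is in $\Gamma$ or in $\Sigma$. *Typing* $\Sigma;\Gamma\vdash t:A$ and $\Sigma;\Gamma\vdash n\Rightarrow A$ ($\Sigma$ is left implicit in the rules): $\mathsf{Set}:\mathsf{Set}$,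 $\mathsf{Bool}:\mathsf{Set}$, $\mathsf{true}:\mathsf{Bool}$, $\mathsf{false}:\mathsf{Bool}$; $\Gamma\vdash (x:A)\to B:\mathsf{Set}$ if $\Gamma\vdash A:\mathsf{Set}$ and $\Gamma,x:A\vdash B:\mathsf{Set}$; $\Gamma\vdash\lambda x\to t:(x:A)\to B$ if $\Gamma,x:A\vdash t:B$; $\Gamma\vdash n:B$ if $\Gamma\vdash n\Rightarrow A$ and $\Gamma\vdash A\equiv B:\mathsf{Set}$. For neutral terms: heads as above; $\Gamma\vdash n\,t\Rightarrow B[x:=t]$ if $\Gamma\vdash n\Rightarrow (x:A)\to B$ and $\Gamma\vdash t:A$; $\Gamma\vdash\mathbf{if}\ n/x.A\ \mathbf{then}\ t\ \mathbf{else}\ u\Rightarrow A[x:=n]$ if $\Gamma\vdash n\Rightarrow\mathsf{Bool}$, $\Gamma,x:\mathsf{Bool}\vdash A:\mathsf{Set}$, $\Gamma\vdash t:A[x:=\mathsf{true}]$ and $\Gamma\vdash u:A[x:=\mathsf{false}]$. *Definitional equality* $\Gamma\vdash t\equiv u:A$ and $\Gamma\vdash n\equiv n'\Rightarrow A$: the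 first has the rules that each of $\mathsf{Set},\mathsf{Bool}$ equals itself at $\mathsf{Set}$ and each of $\mathsf{true},\mathsf{false}$ equals itself at $\mathsf{Bool}$; $(x:A_1)\to B_1\equiv(x:A_2)\to B_2:\mathsf{Set}$ if $\Gamma\vdash A_1\equiv A_2:\mathsf{Set}$ and $\Gamma,x:A_1\vdash B_1\equiv B_2:\mathsf{Set}$; $\Gamma\vdash f\equiv g:(x:A)\to B$ if $\Gamma,x:A\vdash f\,x\equiv g\,x:B$; $\Gamma\vdash n\equiv n':B$ if $\Gamma\vdash n\equiv n'\Rightarrow A$ and $\Gamma\vdash A\equiv B:\mathsf{Set}$. The second relates each head to itself at its type, and is congruent for application and $\mathbf{if}$, with types $B[x:=t]$ and $A[x:=n]$ taken from the left-hand sides, as in the typing rules. *Well-formedness.* $\vdash\Sigma$: each type in $\Sigma$ has type $\mathsf{Set}$ in the empty context over the preceding signature. $\Sigma\vdash\Gamma$: each type in $\Gamma$ has type $\mathsf{Set}$ in the preceding context. A constraint $\Delta\vdash t:A=u:B$ is well formed over $\Sigma$ if $\Sigma\vdash\Delta$, $\Sigma;\Delta\vdash t:A$ and $\Sigma;\Delta\vdash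 u:B$. For a set $\mathcal C$ of constraints, $\Sigma;\Gamma\vdash\mathcal C$ means that every constraint in $\mathcal C$ is well formed over $\Sigma$, in a context that extends $\Gamma$. *Elaboration* is the following pair of mutually inductive relations, $[\![\Sigma;\Gamma\vdash t]\!]\leadsto\Xi\mid\mathcal C\vdash t'\Rightarrow A$ (inference mode) and $[\![\Sigma;\Gamma\vdash t\Leftarrow A]\!]\leadsto\Xi\mid\mathcal C\vdash t'$ (checking mode). In the rules, the signature is threaded from left to right through the premises, the constraints of all premises are united, and $\alpha:=\mathrm{Fresh}(\Gamma,A)$ appends a fresh meta-variable $\alpha:\Gamma\to A$ to the signature, later occurrences of $\alpha$ standing for $\alpha$ applied to all variables of $\Gamma$. Checking $t\Leftarrow A$ in $\Gamma$: infer $u\Rightarrow B$ for $t$, set $\alpha:=\mathrm{Fresh}(\Gamma,A)$, return $\alpha$ and add the constraint $\Gamma\vdash u:B=\alpha:A$. Inference in $\Gamma$: - $\mathsf{Set}$, $\mathsf{Bool}$, $\mathsf{true}$, $\mathsf{false}$ and heads in scope return themselves and their types, without constraints. - $(x:A)\to B$: check $A\Leftarrow\mathsf{Set}$, giving $A'$;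 check $B\Leftarrow\mathsf{Set}$ in $\Gamma,x:A'$, giving $B'$; return $(x:A')\to B'\Rightarrow\mathsf{Set}$. - $\lambda x\to t$: $\beta:=\mathrm{Fresh}(\Gamma,\mathsf{Set})$, $\gamma:=\mathrm{Fresh}((\Gamma,x:\beta),\mathsf{Set})$; check $t\Leftarrow\gamma$ in $\Gamma,x:\beta$, giving $u$; return $\lambda x\to u\Rightarrow(x:\beta)\to\gamma$. - $n\,u$: $\beta,\gamma$ as before; check $n\Leftarrow(x:\beta)\to\gamma$, giving $t$; check $u\Leftarrow\beta$, giving $v$; return $t\,v\Rightarrow\gamma[x:=v]$. - $\mathbf{if}\ n/x.B\ \mathbf{then}\ u\ \mathbf{else}\ v$: check $B\Leftarrow\mathsf{Set}$ in $\Gamma,x:\mathsf{Bool}$, giving $B'$; check $n\Leftarrow\mathsf{Bool}$, giving $t$; check $u\Leftarrow B'[x:=\mathsf{true}]$, giving $u'$; check $v\Leftarrow B'[x:=\mathsf{false}]$, giving $v'$; return $\mathbf{if}\ t/x.B'\ \mathbf{then}\ u'\ \mathbf{else}\ v'\Rightarrow B'[x:=t]$. Meta-variables are identified with their positions in the signature,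 so that the choice of a fresh meta-variable is determined. **Lemma (Well-formedness and functionality of elaboration).** Let $\vdash\Sigma$ and $\Sigma\vdash\Gamma$, and let $t$ be a (not necessarily well-typed) term whose free variables are declared in $\Gamma$ and whose meta-variables are declared in $\Sigma$. 1. There are unique $\Xi,\mathcal C,t',A$ with $[\![\Sigma;\Gamma\vdash t]\!]\leadsto\Xi\mid\mathcal C\vdash t'\Rightarrow A$, and $\Xi;\Gamma\vdash A:\mathsf{Set}$. 2. For every $A$ with $\Sigma;\Gamma\vdash A:\mathsf{Set}$ there are unique $\Xi,\mathcal C,t'$ with $[\![\Sigma;\Gamma\vdash t\Leftarrow A]\!]\leadsto\Xi\mid\mathcal C\vdash t'$. In both cases $\Xi$ extends $\Sigma$ (the list $\Sigma$ is an initial segment of $\Xi$), $\vdash\Xi$, $\Xi;\Gamma\vdash t':A$, and $\Xi;\Gamma\vdash\mathcal C$. -/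

import Mathlib

/-!
A dependent type theory with booleans, one universe and meta-variables, in beta-normal form, and an
elaboration procedure for it.  Bound and free variables are de Bruijn indices.  Meta-variables are
de Bruijn levels: the meta-variable `α` is the `α`-th entry of the signature.  So terms are taken up
to renaming, names are never duplicated, and the fresh meta-variable of a signature `S` is the
level `S.length`.
-/

namespace Elab

/-- Heads of neutral terms: variables (indices) and meta-variables (levels). -/
inductive Head : Type
  | var (i : ℕ)
  | mvar (α : ℕ)

mutual
/-- Types and terms, always in beta-normal form. -/
inductive Tm : Type
  | univ
  | bool
  | tru
  | fls
  /-- `(x : A) → B`; `B` has one more variable -/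
  | pi (A B : Tm)
  /-- `λ x → t`; `t` has one more variable -/
  | lam (t : Tm)
  | neu (n : Ne)
/-- Neutral terms. -/
inductive Ne : Type
  | head (h : Head)
  | app (n : Ne) (t : Tm)
  /-- `if n / x. A then t else u`; `A` has one more variable -/
  | ite (n : Ne) (A t u : Tm)
end

/-- Contexts; the most recent variable comes first. The type of a variable lives in the tail. -/
abbrev Ctx := List Tm

/-- Signatures: lists of (closed) types of meta-variables; the most recent one comes last. -/
abbrev Sig := List Tm

/-- The term consisting of the variable with index `i`. -/
def Tm.var (i : ℕ) : Tm := .neu (.head (.var i))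

/-! ### Renaming of variables -/

/-- Extend a renaming under a binder. -/
def lift (ρ : ℕ → ℕ) : ℕ → ℕ
  | 0 => 0
  | i + 1 => ρ i + 1

def Head.rename (ρ : ℕ → ℕ) : Head → Head
  | .var i => .var (ρ i)
  | .mvar α => .mvar α

mutual
def Tm.rename (ρ : ℕ → ℕ) : Tm → Tm
  | .univ => .univ
  | .bool => .bool
  | .tru => .tru
  | .fls => .fls
  | .pi A B => .pi (A.rename ρ) (B.rename (lift ρ))
  | .lam t => .lam (t.rename (lift ρ))
  | .neu n => .neu (n.rename ρ)
def Ne.rename (ρ : ℕ → ℕ) : Ne → Ne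
  | .head h => .head (h.rename ρ)
  | .app n t => .app (n.rename ρ) (t.rename ρ)
  | .ite n A t u => .ite (n.rename ρ) (A.rename (lift ρ)) (t.rename ρ) (u.rename ρ)
end

/-- Weakening by one variable. -/
def Tm.shift (t : Tm) : Tm := t.rename Nat.succ

/-! ### Scoping -/

/-- All meta-variables are among the first `m` ones, all free variables among the first `k`. -/
def Head.Scoped (m k : ℕ) : Head → Prop
  | .var i => i < k
  | .mvar α => α < m

mutual
/-- All meta-variables are among the first `m` ones, all free variables among the first `k`. -/
def Tm.Scoped (m : ℕ) (k : ℕ) : Tm → Prop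
  | .univ => True
  | .bool => True
  | .tru => True
  | .fls => True
  | .pi A B => A.Scoped m k ∧ B.Scoped m (k + 1)
  | .lam t => t.Scoped m (k + 1)
  | .neu n => n.Scoped m k
/-- All meta-variables are among the first `m` ones, all free variables among the first `k`. -/
def Ne.Scoped (m : ℕ) (k : ℕ) : Ne → Prop
  | .head h => h.Scoped m k
  | .app n t => n.Scoped m k ∧ t.Scoped m k
  | .ite n A t u => n.Scoped m k ∧ A.Scoped m (k + 1) ∧ t.Scoped m k ∧ u.Scoped m k
end

/-! ### Hereditary substitution and elimination

The theory has `Set : Set` and substitution also applies to untyped terms, so hereditary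
substitution need not terminate; it is a relation. -/

/-- `IfElim t A u v w`: `if t / x. A then u else v` evaluates to `w`. -/
inductive IfElim : Tm → Tm → Tm → Tm → Tm → Prop
  | tru {A u v} : IfElim .tru A u v u
  | fls {A u v} : IfElim .fls A u v v
  | neu {n A u v} : IfElim (.neu n) A u v (.neu (.ite n A u v))

mutual
/-- `Subst k u t t'`: the term `t[k := u]` evaluates to `t'`. The variable `k` disappears, so larger
indices decrease by one. -/
inductive Subst : ℕ → Tm → Tm → Tm → Prop
  | univ {k u} : Subst k u .univ .univ
  | bool {k u} : Subst k u .bool .bool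
  | tru {k u} : Subst k u .tru .tru
  | fls {k u} : Subst k u .fls .fls
  | pi {k u A A' B B'} : Subst k u A A' → Subst (k + 1) u.shift B B' →
      Subst k u (.pi A B) (.pi A' B')
  | lam {k u t t'} : Subst (k + 1) u.shift t t' → Subst k u (.lam t) (.lam t')
  | neu {k u n s} : SubstNe k u n s → Subst k u (.neu n) s
/-- `SubstNe k u n t'`: the neutral term `n`, with `u` for the variable `k`, evaluates to `t'`. -/
inductive SubstNe : ℕ → Tm → Ne → Tm → Prop
  | var_eq {k u} : SubstNe k u (.head (.var k)) u
  | var_lt {k u i} : i < k → SubstNe k u (.head (.var i)) (.var i)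
  | var_gt {k u i} : k ≤ i → SubstNe k u (.head (.var (i + 1))) (.var i)
  | mvar {k u α} : SubstNe k u (.head (.mvar α)) (.neu (.head (.mvar α)))
  | app {k u n t v t' w} : SubstNe k u n v → Subst k u t t' → AppElim v t' w →
      SubstNe k u (.app n t) w
  | ite {k u n A t s v A' t' s' w} : SubstNe k u n v → Subst (k + 1) u.shift A A' →
      Subst k u t t' → Subst k u s s' → IfElim v A' t' s' w →
      SubstNe k u (.ite n A t s) w
/-- `AppElim t u v`: the application `t u` evaluates to `v`. -/
inductive AppElim : Tm → Tm → Tm → Prop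
  | lam {t u t'} : Subst 0 u t t' → AppElim (.lam t) u t'
  | neu {n u} : AppElim (.neu n) u (.neu (.app n u))
end

/-! ### Definitional equality -/

/-- Types of heads: `S ; Γ ⊢ h ⇒ A`. Types in a signature are closed and need no weakening. -/
inductive HeadTy (S : Sig) (Γ : Ctx) : Head → Tm → Prop
  | var {i A} : Γ[i]? = some A → HeadTy S Γ (.var i) (A.rename (fun j => j + (i + 1)))
  | mvar {α A} : S[α]? = some A → HeadTy S Γ (.mvar α) A

mutual
/-- `S ; Γ ⊢ t ≡ u : A`. -/
inductive Conv (S : Sig) : Ctx → Tm → Tm → Tm → Prop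
  | univ {Γ} : Conv S Γ .univ .univ .univ
  | bool {Γ} : Conv S Γ .bool .bool .univ
  | tru {Γ} : Conv S Γ .tru .tru .bool
  | fls {Γ} : Conv S Γ .fls .fls .bool
  | pi {Γ A₁ A₂ B₁ B₂} : Conv S Γ A₁ A₂ .univ → Conv S (A₁ :: Γ) B₁ B₂ .univ →
      Conv S Γ (.pi A₁ B₁) (.pi A₂ B₂) .univ
  | eta {Γ A B f g f' g'} : AppElim f.shift (.var 0) f' → AppElim g.shift (.var 0) g' →
      Conv S (A :: Γ) f' g' B → Conv S Γ f g (.pi A B)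
  | neu {Γ n n' A B} : ConvNe S Γ n n' A → Conv S Γ A B .univ → Conv S Γ (.neu n) (.neu n') B
/-- `S ; Γ ⊢ n ≡ n' ⇒ A`. -/
inductive ConvNe (S : Sig) : Ctx → Ne → Ne → Tm → Prop
  | head {Γ h A} : HeadTy S Γ h A → ConvNe S Γ (.head h) (.head h) A
  | app {Γ n n' t t' A B T} : ConvNe S Γ n n' (.pi A B) → Conv S Γ t t' A → Subst 0 t B T →
      ConvNe S Γ (.app n t) (.app n' t') T
  | ite {Γ n n' A A' t t' u u' At Af T} : ConvNe S Γ n n' .bool →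
      Conv S (.bool :: Γ) A A' .univ →
      Subst 0 .tru A At → Conv S Γ t t' At →
      Subst 0 .fls A Af → Conv S Γ u u' Af →
      Subst 0 (.neu n) A T →
      ConvNe S Γ (.ite n A t u) (.ite n' A' t' u') T
end

/-! ### Typing -/

mutual
/-- `S ; Γ ⊢ t : A`. -/
inductive HasTy (S : Sig) : Ctx → Tm → Tm → Prop
  | univ {Γ} : HasTy S Γ .univ .univ
  | bool {Γ} : HasTy S Γ .bool .univ
  | tru {Γ} : HasTy S Γ .tru .bool
  | fls {Γ} : HasTy S Γ .fls .bool
  | pi {Γ A B} : HasTy S Γ A .univ → HasTy S (A :: Γ) B .univ → HasTy S Γ (.pi A B) .univ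
  | lam {Γ A B t} : HasTy S (A :: Γ) t B → HasTy S Γ (.lam t) (.pi A B)
  | neu {Γ n A B} : NeTy S Γ n A → Conv S Γ A B .univ → HasTy S Γ (.neu n) B
/-- `S ; Γ ⊢ n ⇒ A`. -/
inductive NeTy (S : Sig) : Ctx → Ne → Tm → Prop
  | head {Γ h A} : HeadTy S Γ h A → NeTy S Γ (.head h) A
  | app {Γ n t A B T} : NeTy S Γ n (.pi A B) → HasTy S Γ t A → Subst 0 t B T →
      NeTy S Γ (.app n t) T
  | ite {Γ n A t u At Af T} : NeTy S Γ n .bool → HasTy S (.bool :: Γ) A .univ →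
      Subst 0 .tru A At → HasTy S Γ t At →
      Subst 0 .fls A Af → HasTy S Γ u Af →
      Subst 0 (.neu n) A T →
      NeTy S Γ (.ite n A t u) T
end

/-- Well-formed signatures, `⊢ S`. -/
inductive SigWF : Sig → Prop
  | nil : SigWF []
  | snoc {S A} : SigWF S → HasTy S [] A .univ → SigWF (S ++ [A])

/-- Well-formed contexts, `S ⊢ Γ`. -/
inductive CtxWF (S : Sig) : Ctx → Prop
  | nil : CtxWF S []
  | cons {Γ A} : CtxWF S Γ → HasTy S Γ A .univ → CtxWF S (A :: Γ)

/-! ### Constraints -/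

/-- Heterogeneous unification constraints `Γ ⊢ lhs : lhsTy = rhs : rhsTy`. -/
structure Constraint where
  ctx : Ctx
  lhs : Tm
  lhsTy : Tm
  rhs : Tm
  rhsTy : Tm

/-- Well-formed constraints over a signature. -/
structure Constraint.WF (S : Sig) (c : Constraint) : Prop where
  ctx_wf : CtxWF S c.ctx
  lhs_ty : HasTy S c.ctx c.lhs c.lhsTy
  rhs_ty : HasTy S c.ctx c.rhs c.rhsTy

/-- `S ; Γ ⊢ C`: every constraint in `C` is well formed, in a context that extends `Γ`
(constraints from below binders live in proper extensions of `Γ`). -/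
def ConstraintsWF (S : Sig) (Γ : Ctx) (C : Set Constraint) : Prop :=
  ∀ c ∈ C, Γ <:+ c.ctx ∧ c.WF S

/-! ### Elaboration -/

/-- `Γ → A`, the iterated function type. -/
def Ctx.arrow : Ctx → Tm → Tm
  | [], A => A
  | B :: Γ, A => Ctx.arrow Γ (.pi B A)

/-- `n` applied to the variables `k - 1, …, 1, 0`, in this order. -/
def Ne.appVars (n : Ne) : ℕ → Ne
  | 0 => n
  | k + 1 => Ne.appVars (.app n (.var k)) k

/-- The signature `S, α : Γ → A`, for a fresh meta-variable `α`. -/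
def Sig.fresh (S : Sig) (Γ : Ctx) (A : Tm) : Sig := S ++ [Ctx.arrow Γ A]

/-- The term `α Γ`, where `α` is the meta-variable that `Sig.fresh S Γ A` adds to `S`. -/
def Sig.freshTm (S : Sig) (Γ : Ctx) : Tm := .neu (Ne.appVars (.head (.mvar S.length)) Γ.length)

mutual
/-- Inference-mode elaboration: `Infer S Γ t Ξ C t' A` is `⟦S ; Γ ⊢ t⟧ ↝ Ξ | C ⊢ t' ⇒ A`. -/
inductive Infer : Sig → Ctx → Tm → Sig → Set Constraint → Tm → Tm → Prop
  | univ {S Γ} : Infer S Γ .univ S ∅ .univ .univ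
  | bool {S Γ} : Infer S Γ .bool S ∅ .bool .univ
  | tru {S Γ} : Infer S Γ .tru S ∅ .tru .bool
  | fls {S Γ} : Infer S Γ .fls S ∅ .fls .bool
  | pi {S Γ A B S₁ Ξ C₁ C₂ A' B'} :
      Check S Γ A .univ S₁ C₁ A' →
      Check S₁ (A' :: Γ) B .univ Ξ C₂ B' →
      Infer S Γ (.pi A B) Ξ (C₁ ∪ C₂) (.pi A' B') .univ
  | lam {S Γ t S₁ S₂ Ξ C β γ u} :
      S₁ = S.fresh Γ .univ → β = S.freshTm Γ →
      S₂ = S₁.fresh (β :: Γ) .univ → γ = S₁.freshTm (β :: Γ) →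
      Check S₂ (β :: Γ) t γ Ξ C u →
      Infer S Γ (.lam t) Ξ C (.lam u) (.pi β γ)
  | head {S Γ h A} : HeadTy S Γ h A → Infer S Γ (.neu (.head h)) S ∅ (.neu (.head h)) A
  | app {S Γ n u S₁ S₂ S₃ Ξ C₁ C₂ β γ t v w T} :
      S₁ = S.fresh Γ .univ → β = S.freshTm Γ →
      S₂ = S₁.fresh (β :: Γ) .univ → γ = S₁.freshTm (β :: Γ) →
      Check S₂ Γ (.neu n) (.pi β γ) S₃ C₁ t →
      Check S₃ Γ u β Ξ C₂ v →
      AppElim t v w → Subst 0 v γ T →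
      Infer S Γ (.neu (.app n u)) Ξ (C₁ ∪ C₂) w T
  | ite {S Γ n B u v S₁ S₂ S₃ Ξ C₁ C₂ C₃ C₄ B' t Bt Bf u' v' w T} :
      Check S (.bool :: Γ) B .univ S₁ C₁ B' →
      Check S₁ Γ (.neu n) .bool S₂ C₂ t →
      Subst 0 .tru B' Bt → Check S₂ Γ u Bt S₃ C₃ u' →
      Subst 0 .fls B' Bf → Check S₃ Γ v Bf Ξ C₄ v' →
      IfElim t B' u' v' w → Subst 0 t B' T →
      Infer S Γ (.neu (.ite n B u v)) Ξ (C₁ ∪ C₂ ∪ C₃ ∪ C₄) w T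
/-- Checking-mode elaboration: `Check S Γ t A Ξ C t'` is `⟦S ; Γ ⊢ t ⇐ A⟧ ↝ Ξ | C ⊢ t'`. The
elaborated term is a fresh meta-variable of type `A`, equated by a new constraint to the term that
is inferred for `t`. -/
inductive Check : Sig → Ctx → Tm → Tm → Sig → Set Constraint → Tm → Prop
  | intro {S Γ t A Ξ C u B} :
      Infer S Γ t Ξ C u B →
      Check S Γ t A (Ξ.fresh Γ A) ({⟨Γ, u, B, Ξ.freshTm Γ, A⟩} ∪ C) (Ξ.freshTm Γ)
end

end Elab

namespace Elab

/-! ### Renamings -/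

-- Elaboration cannot get stuck, because checking never returns anything but a fresh meta-variable
-- applied to the variables of the context. Every subterm is checked, so the eliminations in the
-- inference rules act on neutral terms and are neutral. The only types that are instantiated, `γ`
-- in applications and `B'` in conditionals, are fresh too: they have the form `α Γ x`, where `α Γ`
-- does not mention `x`. So the instance at any `v` is defined and equals `α Γ v`
-- (`Sig.subst_freshTm_cons`). The same observation gives typing. As `Γ, x : B → Set` unfolds to `Γ
-- → ((x : B) → Set)`, the term `α Γ` is a type family on `B`, and `α Γ v : Set` is one application
-- of it (`Sig.freshNe_ty_family`, `NeTy.app_family`). Hence neither a substitution lemma, nor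
-- transitivity of conversion, nor normalisation enters. What remains is weakening of signatures
-- (`sig_mono`), renaming of contexts (`HasTy.rename`), reflexivity of conversion
-- (`HasTy.conv_refl`), and the typing of `α Γ` (`NeTy.appVars`). Existence and uniqueness are
-- structural inductions on the term: the rules are syntax-directed, checking reduces to inference
-- for the same term, and hereditary substitution and elimination are functional.

theorem lift_id : lift id = id := by
  funext i; cases i <;> rfl

theorem lift_comp (ρ σ : ℕ → ℕ) : lift (ρ ∘ σ) = lift ρ ∘ lift σ := by
  funext i; cases i <;> rfl

theorem Head.rename_id (h : Head) : h.rename id = h := by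
  cases h <;> rfl

theorem Head.rename_rename (ρ σ : ℕ → ℕ) (h : Head) :
    (h.rename σ).rename ρ = h.rename (ρ ∘ σ) := by
  cases h <;> rfl

mutual
theorem Tm.rename_id : ∀ t : Tm, t.rename id = t
  | .univ | .bool | .tru | .fls => by simp [Tm.rename]
  | .pi A B => by simp [Tm.rename, lift_id, Tm.rename_id A, Tm.rename_id B]
  | .lam t => by simp [Tm.rename, lift_id, Tm.rename_id t]
  | .neu n => by simp [Tm.rename, Ne.rename_id n]
theorem Ne.rename_id : ∀ n : Ne, n.rename id = n
  | .head h => by simp [Ne.rename, Head.rename_id]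
  | .app n t => by simp [Ne.rename, Ne.rename_id n, Tm.rename_id t]
  | .ite n A t u => by
    simp [Ne.rename, lift_id, Ne.rename_id n, Tm.rename_id A, Tm.rename_id t, Tm.rename_id u]
end

mutual
theorem Tm.rename_rename : ∀ (ρ σ : ℕ → ℕ) (t : Tm),
    (t.rename σ).rename ρ = t.rename (ρ ∘ σ)
  | _, _, .univ | _, _, .bool | _, _, .tru | _, _, .fls => by simp [Tm.rename]
  | ρ, σ, .pi A B => by
    simp [Tm.rename, lift_comp, Tm.rename_rename ρ σ A, Tm.rename_rename _ _ B]
  | ρ, σ, .lam t => by simp [Tm.rename, lift_comp, Tm.rename_rename _ _ t]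
  | ρ, σ, .neu n => by simp [Tm.rename, Ne.rename_rename ρ σ n]
theorem Ne.rename_rename : ∀ (ρ σ : ℕ → ℕ) (n : Ne),
    (n.rename σ).rename ρ = n.rename (ρ ∘ σ)
  | ρ, σ, .head h => by simp [Ne.rename, Head.rename_rename]
  | ρ, σ, .app n t => by simp [Ne.rename, Ne.rename_rename ρ σ n, Tm.rename_rename ρ σ t]
  | ρ, σ, .ite n A t u => by
    simp [Ne.rename, lift_comp, Ne.rename_rename ρ σ n, Tm.rename_rename _ _ A,
      Tm.rename_rename ρ σ t, Tm.rename_rename ρ σ u]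
end

-- Scoped terms

theorem lift_eq_self {k : ℕ} {ρ : ℕ → ℕ} (h : ∀ i < k, ρ i = i) :
    ∀ i < k + 1, lift ρ i = i
  | 0, _ => rfl
  | i + 1, hi => congrArg (· + 1) (h i (by omega))

mutual
-- The case of interest is `k = 0`: types in a signature are closed, so no renaming affects them.
-- Larger `k` arise under binders.
theorem Tm.rename_of_scoped {m : ℕ} : ∀ {k : ℕ} {ρ : ℕ → ℕ} (t : Tm), t.Scoped m k →
    (∀ i < k, ρ i = i) → t.rename ρ = t
  | _, _, .univ, _, _ | _, _, .bool, _, _ | _, _, .tru, _, _ | _, _, .fls, _, _ => by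
    simp [Tm.rename]
  | _, _, .pi A B, h, hρ => by
    simp only [Tm.Scoped] at h
    simp [Tm.rename, Tm.rename_of_scoped A h.1 hρ, Tm.rename_of_scoped B h.2 (lift_eq_self hρ)]
  | _, _, .lam t, h, hρ => by
    simp only [Tm.Scoped] at h
    simp [Tm.rename, Tm.rename_of_scoped t h (lift_eq_self hρ)]
  | _, _, .neu n, h, hρ => by
    simp only [Tm.Scoped] at h
    simp [Tm.rename, Ne.rename_of_scoped n h hρ]
theorem Ne.rename_of_scoped {m : ℕ} : ∀ {k : ℕ} {ρ : ℕ → ℕ} (n : Ne), n.Scoped m k →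
    (∀ i < k, ρ i = i) → n.rename ρ = n
  | _, _, .head (.var i), h, hρ => by
    simp only [Ne.Scoped, Head.Scoped] at h
    simp [Ne.rename, Head.rename, hρ i h]
  | _, _, .head (.mvar _), _, _ => by simp [Ne.rename, Head.rename]
  | _, _, .app n t, h, hρ => by
    simp only [Ne.Scoped] at h
    simp [Ne.rename, Ne.rename_of_scoped n h.1 hρ, Tm.rename_of_scoped t h.2 hρ]
  | _, _, .ite n A t u, h, hρ => by
    simp only [Ne.Scoped] at h
    simp [Ne.rename, Ne.rename_of_scoped n h.1 hρ,
      Tm.rename_of_scoped A h.2.1 (lift_eq_self hρ), Tm.rename_of_scoped t h.2.2.1 hρ,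
      Tm.rename_of_scoped u h.2.2.2 hρ]
end

mutual
theorem Tm.Scoped.mono {m m' : ℕ} (hm : m ≤ m') : ∀ {k : ℕ} (t : Tm),
    t.Scoped m k → t.Scoped m' k
  | _, .univ, _ | _, .bool, _ | _, .tru, _ | _, .fls, _ => by simp [Tm.Scoped]
  | _, .pi A B, h => by
    simp only [Tm.Scoped] at h ⊢
    exact ⟨Tm.Scoped.mono hm A h.1, Tm.Scoped.mono hm B h.2⟩
  | _, .lam t, h => by
    simp only [Tm.Scoped] at h ⊢
    exact Tm.Scoped.mono hm t h
  | _, .neu n, h => by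
    simp only [Tm.Scoped] at h ⊢
    exact Ne.Scoped.mono hm n h
theorem Ne.Scoped.mono {m m' : ℕ} (hm : m ≤ m') : ∀ {k : ℕ} (n : Ne),
    n.Scoped m k → n.Scoped m' k
  | _, .head (.var i), h => by simpa only [Ne.Scoped, Head.Scoped] using h
  | _, .head (.mvar α), h => by
    simp only [Ne.Scoped, Head.Scoped] at h ⊢
    omega
  | _, .app n t, h => by
    simp only [Ne.Scoped] at h ⊢
    exact ⟨Ne.Scoped.mono hm n h.1, Tm.Scoped.mono hm t h.2⟩
  | _, .ite n A t u, h => by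
    simp only [Ne.Scoped] at h ⊢
    exact ⟨Ne.Scoped.mono hm n h.1, Tm.Scoped.mono hm A h.2.1, Tm.Scoped.mono hm t h.2.2.1,
      Tm.Scoped.mono hm u h.2.2.2⟩
end

theorem Tm.shift_rename (ρ : ℕ → ℕ) (t : Tm) :
    t.shift.rename (lift ρ) = (t.rename ρ).shift := by
  simp only [Tm.shift, Tm.rename_rename]; rfl

/-! ### Substitution and renaming -/

/-- The renaming `ρ` under `k` binders. -/
def liftN (k : ℕ) (ρ : ℕ → ℕ) (i : ℕ) : ℕ := if i < k then i else ρ (i - k) + k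

theorem liftN_zero (ρ : ℕ → ℕ) : liftN 0 ρ = ρ := by
  funext i; simp [liftN]

theorem lift_liftN (k : ℕ) (ρ : ℕ → ℕ) : lift (liftN k ρ) = liftN (k + 1) ρ := by
  funext i
  cases i with
  | zero => simp [lift, liftN]
  | succ i => simp only [lift, liftN]; split_ifs <;> grind

theorem liftN_one (ρ : ℕ → ℕ) : liftN (0 + 1) ρ = lift ρ := by
  rw [← lift_liftN, liftN_zero]

theorem IfElim.rename (ρ : ℕ → ℕ) {t A u v w : Tm} (h : IfElim t A u v w) :
    IfElim (t.rename ρ) (A.rename (lift ρ)) (u.rename ρ) (v.rename ρ) (w.rename ρ) := by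
  cases h <;> simp only [Tm.rename, Ne.rename] <;> constructor

mutual
-- The induction is on derivations, since a hereditary substitution may start new ones that are not
-- on subterms. Binders raise `k`; a β-step restarts at index `0`, with `liftN k ρ` as the new
-- renaming.
theorem Subst.rename_liftN (ρ : ℕ → ℕ) : ∀ {k : ℕ} {u t t' : Tm}, Subst k u t t' →
    Subst k (u.rename (liftN k ρ)) (t.rename (liftN (k + 1) ρ)) (t'.rename (liftN k ρ))
  | _, _, _, _, .univ => by simp only [Tm.rename]; exact .univ
  | _, _, _, _, .bool => by simp only [Tm.rename]; exact .bool
  | _, _, _, _, .tru => by simp only [Tm.rename]; exact .tru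
  | _, _, _, _, .fls => by simp only [Tm.rename]; exact .fls
  | _, _, _, _, .pi hA hB => by
    simp only [Tm.rename]
    have h := Subst.rename_liftN ρ hB
    -- Writing `liftN (k + 1) ρ` as a lift lets the renaming pass through the shift of the
    -- substituted term.
    rw [← lift_liftN _ ρ, Tm.shift_rename, ← lift_liftN (_ + 1) ρ, ← lift_liftN _ ρ] at h
    rw [← lift_liftN _ ρ]
    exact .pi (by rw [lift_liftN]; exact Subst.rename_liftN ρ hA) h
  | _, _, _, _, .lam ht => by
    simp only [Tm.rename]
    have h := Subst.rename_liftN ρ ht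
    rw [← lift_liftN _ ρ, Tm.shift_rename, ← lift_liftN (_ + 1) ρ, ← lift_liftN _ ρ] at h
    rw [← lift_liftN _ ρ]
    exact .lam h
  | _, _, _, _, .neu hn => by
    simp only [Tm.rename]
    exact .neu (SubstNe.rename_liftN ρ hn)
theorem SubstNe.rename_liftN (ρ : ℕ → ℕ) : ∀ {k : ℕ} {u : Tm} {n : Ne} {t' : Tm},
    SubstNe k u n t' →
    SubstNe k (u.rename (liftN k ρ)) (n.rename (liftN (k + 1) ρ)) (t'.rename (liftN k ρ))
  | k, _, _, _, .var_eq => by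
    have h : liftN (k + 1) ρ k = k := by simp [liftN]
    simp only [Ne.rename, Head.rename, h]
    exact .var_eq
  | k, _, _, _, .var_lt (i := i) hi => by
    have h : liftN (k + 1) ρ i = i := if_pos (by omega)
    have h' : liftN k ρ i = i := if_pos hi
    simp only [Tm.var, Tm.rename, Ne.rename, Head.rename, h, h']
    exact .var_lt hi
  | k, _, _, _, .var_gt (i := i) hi => by
    have h : liftN (k + 1) ρ (i + 1) = liftN k ρ i + 1 := by
      rw [← lift_liftN]; rfl
    have h' : k ≤ liftN k ρ i := by
      rw [liftN, if_neg (by omega)]; omega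
    simp only [Tm.var, Tm.rename, Ne.rename, Head.rename, h]
    exact .var_gt h'
  | _, _, _, _, .mvar => by
    simp only [Tm.rename, Ne.rename, Head.rename]; exact .mvar
  | _, _, _, _, .app hn ht hw => by
    simp only [Ne.rename]
    exact .app (SubstNe.rename_liftN ρ hn) (Subst.rename_liftN ρ ht) (AppElim.rename _ hw)
  | _, _, _, _, .ite hn hA ht hs hw => by
    simp only [Ne.rename]
    have h := Subst.rename_liftN ρ hA
    rw [← lift_liftN _ ρ, Tm.shift_rename, ← lift_liftN (_ + 1) ρ, ← lift_liftN _ ρ] at h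
    rw [← lift_liftN _ ρ]
    refine .ite ?_ h ?_ ?_ (IfElim.rename _ hw)
    · rw [lift_liftN]; exact SubstNe.rename_liftN ρ hn
    · rw [lift_liftN]; exact Subst.rename_liftN ρ ht
    · rw [lift_liftN]; exact Subst.rename_liftN ρ hs
theorem AppElim.rename : ∀ (ρ : ℕ → ℕ) {t u w : Tm}, AppElim t u w →
    AppElim (t.rename ρ) (u.rename ρ) (w.rename ρ)
  | ρ, _, _, _, .lam h => by
    have h' := Subst.rename_liftN ρ h
    rw [liftN_one, liftN_zero] at h'
    simp only [Tm.rename]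
    exact .lam h'
  | _, _, _, _, .neu => by
    simp only [Tm.rename, Ne.rename]; exact .neu
end

theorem Subst.rename (ρ : ℕ → ℕ) {u t t' : Tm} (h : Subst 0 u t t') :
    Subst 0 (u.rename ρ) (t.rename (lift ρ)) (t'.rename ρ) := by
  have h' := Subst.rename_liftN ρ h
  rwa [liftN_one, liftN_zero] at h'

/-- The renaming which substitutes the variable `v` for the variable `k`. -/
def instVar (k v i : ℕ) : ℕ := if i < k then i else if i = k then v else i - 1

theorem lift_instVar (k v : ℕ) : lift (instVar k v) = instVar (k + 1) (v + 1) := by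
  funext i
  cases i with
  | zero => simp [lift, instVar]
  | succ i => simp only [lift, instVar]; split_ifs <;> omega

theorem Tm.shift_var (v : ℕ) : (Tm.var v).shift = Tm.var (v + 1) := by
  simp [Tm.shift, Tm.var, Tm.rename, Ne.rename, Head.rename]

mutual
-- A variable in head position creates no redex, so substituting one is always defined and is a mere
-- renaming.
theorem Subst.of_var : ∀ (k v : ℕ) (t : Tm), Subst k (.var v) t (t.rename (instVar k v))
  | _, _, .univ => by simp only [Tm.rename]; exact .univ
  | _, _, .bool => by simp only [Tm.rename]; exact .bool
  | _, _, .tru => by simp only [Tm.rename]; exact .tru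
  | _, _, .fls => by simp only [Tm.rename]; exact .fls
  | k, v, .pi A B => by
    simp only [Tm.rename, lift_instVar]
    exact .pi (Subst.of_var k v A) (by rw [Tm.shift_var]; exact Subst.of_var _ _ B)
  | k, v, .lam t => by
    simp only [Tm.rename, lift_instVar]
    exact .lam (by rw [Tm.shift_var]; exact Subst.of_var _ _ t)
  | k, v, .neu n => by
    simp only [Tm.rename]
    exact .neu (SubstNe.of_var k v n)
theorem SubstNe.of_var : ∀ (k v : ℕ) (n : Ne),
    SubstNe k (.var v) n (.neu (n.rename (instVar k v)))
  | k, v, .head (.var i) => by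
    simp only [Ne.rename, Head.rename]
    rcases lt_trichotomy i k with h | rfl | h
    · rw [show instVar k v i = i from if_pos h]; exact .var_lt h
    · rw [show instVar i v i = v by simp [instVar]]; exact .var_eq
    · obtain ⟨j, rfl⟩ : ∃ j, i = j + 1 := ⟨i - 1, by omega⟩
      rw [show instVar k v (j + 1) = j by simp only [instVar]; split_ifs <;> omega]
      exact .var_gt (by omega)
  | _, _, .head (.mvar _) => by simp only [Ne.rename, Head.rename]; exact .mvar
  | k, v, .app n t => by
    simp only [Ne.rename]
    exact .app (SubstNe.of_var k v n) (Subst.of_var k v t) .neu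
  | k, v, .ite n A t u => by
    simp only [Ne.rename, lift_instVar]
    exact .ite (SubstNe.of_var k v n) (by rw [Tm.shift_var]; exact Subst.of_var _ _ A)
      (Subst.of_var k v t) (Subst.of_var k v u) .neu
end

/-- This computes both the η-expansion of an abstraction and the type of a weakened function applied
to the newest variable. -/
theorem Subst.var_zero (t : Tm) : Subst 0 (.var 0) (t.rename (lift Nat.succ)) t := by
  have h := Subst.of_var 0 0 (t.rename (lift Nat.succ))
  have e : instVar 0 0 ∘ lift Nat.succ = id := by
    funext i; cases i <;> simp [instVar, lift]
  rwa [Tm.rename_rename, e, Tm.rename_id] at h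

/-- The renaming which skips the variable `k`. -/
def skip (k i : ℕ) : ℕ := if i < k then i else i + 1

theorem lift_skip (k : ℕ) : lift (skip k) = skip (k + 1) := by
  funext i
  cases i with
  | zero => simp [lift, skip]
  | succ i => simp only [lift, skip]; split_ifs <;> omega

mutual
-- The variable `k` does not occur, so no redex arises and the result exists for every `u`, even an
-- ill-typed one.
theorem Subst.rename_skip : ∀ (k : ℕ) (u t : Tm), Subst k u (t.rename (skip k)) t
  | _, _, .univ => by simp only [Tm.rename]; exact .univ
  | _, _, .bool => by simp only [Tm.rename]; exact .bool
  | _, _, .tru => by simp only [Tm.rename]; exact .tru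
  | _, _, .fls => by simp only [Tm.rename]; exact .fls
  | k, u, .pi A B => by
    simp only [Tm.rename, lift_skip]
    exact .pi (Subst.rename_skip k u A) (Subst.rename_skip _ _ B)
  | k, u, .lam t => by
    simp only [Tm.rename, lift_skip]
    exact .lam (Subst.rename_skip _ _ t)
  | k, u, .neu n => by
    simp only [Tm.rename]
    exact .neu (SubstNe.rename_skip k u n)
theorem SubstNe.rename_skip : ∀ (k : ℕ) (u : Tm) (n : Ne),
    SubstNe k u (n.rename (skip k)) (.neu n)
  | k, u, .head (.var i) => by
    simp only [Ne.rename, Head.rename, skip]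
    split_ifs with h
    · exact .var_lt h
    · exact .var_gt (by omega)
  | _, _, .head (.mvar _) => by simp only [Ne.rename, Head.rename]; exact .mvar
  | k, u, .app n t => by
    simp only [Ne.rename]
    exact .app (SubstNe.rename_skip k u n) (Subst.rename_skip k u t) .neu
  | k, u, .ite n A t s => by
    simp only [Ne.rename, lift_skip]
    exact .ite (SubstNe.rename_skip k u n) (Subst.rename_skip _ _ A)
      (Subst.rename_skip k u t) (Subst.rename_skip k u s) .neu
end

theorem SubstNe.rename_succ (u : Tm) (n : Ne) : SubstNe 0 u (n.rename Nat.succ) (.neu n) := by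
  have e : skip 0 = Nat.succ := by funext i; simp [skip]
  simpa [e] using SubstNe.rename_skip 0 u n

/-! ### Functionality of substitution -/

theorem IfElim.functional {t A u v w w' : Tm} (h : IfElim t A u v w) (h' : IfElim t A u v w') :
    w' = w := by
  cases h <;> cases h' <;> rfl

mutual
-- At most one rule applies to each input. Induction on the first derivation replaces the missing
-- termination argument.
theorem Subst.functional : ∀ {k : ℕ} {u t t₁ t₂ : Tm}, Subst k u t t₁ → Subst k u t t₂ → t₂ = t₁
  | _, _, _, _, _, .univ, h' => by cases h'; rfl
  | _, _, _, _, _, .bool, h' => by cases h'; rfl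
  | _, _, _, _, _, .tru, h' => by cases h'; rfl
  | _, _, _, _, _, .fls, h' => by cases h'; rfl
  | _, _, _, _, _, .pi hA hB, h' => by
    cases h' with
    | pi hA' hB' => rw [Subst.functional hA hA', Subst.functional hB hB']
  | _, _, _, _, _, .lam ht, h' => by
    cases h' with
    | lam ht' => rw [Subst.functional ht ht']
  | _, _, _, _, _, .neu hn, h' => by
    cases h' with
    | neu hn' => exact SubstNe.functional hn hn'
theorem SubstNe.functional : ∀ {k : ℕ} {u : Tm} {n : Ne} {t₁ t₂ : Tm},
    SubstNe k u n t₁ → SubstNe k u n t₂ → t₂ = t₁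
  | _, _, _, _, _, .var_eq, h' => by
    cases h' with
    | var_eq => rfl
    | var_lt hi => omega
    | var_gt hi => omega
  | _, _, _, _, _, .var_lt hi, h' => by
    cases h' with
    | var_eq => omega
    | var_lt _ => rfl
    | var_gt _ => omega
  | _, _, _, _, _, .var_gt hi, h' => by
    cases h' with
    | var_eq => omega
    | var_lt _ => omega
    | var_gt _ => rfl
  | _, _, _, _, _, .mvar, h' => by cases h'; rfl
  | _, _, _, _, _, .app hn ht hw, h' => by
    cases h' with
    | app hn' ht' hw' =>
      rw [SubstNe.functional hn hn', Subst.functional ht ht'] at hw'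
      exact AppElim.functional hw hw'
  | _, _, _, _, _, .ite hn hA ht hs hw, h' => by
    cases h' with
    | ite hn' hA' ht' hs' hw' =>
      rw [SubstNe.functional hn hn', Subst.functional hA hA', Subst.functional ht ht',
        Subst.functional hs hs'] at hw'
      exact IfElim.functional hw hw'
theorem AppElim.functional : ∀ {t u w₁ w₂ : Tm}, AppElim t u w₁ → AppElim t u w₂ → w₂ = w₁
  | _, _, _, _, .lam h, h' => by
    cases h' with
    | lam h' => exact Subst.functional h h'
  | _, _, _, _, .neu, h' => by cases h'; rfl
end

/-! ### Weakening of signatures -/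

/-- Levels of meta-variables are unaffected by appending entries, so terms need no adjustment when
the signature grows. -/
theorem HeadTy.sig_mono {S Ξ : Sig} (hS : S <+: Ξ) {Γ : Ctx} {h : Head} {A : Tm}
    (hh : HeadTy S Γ h A) : HeadTy Ξ Γ h A := by
  cases hh with
  | var h => exact .var h
  | mvar h =>
    obtain ⟨E, rfl⟩ := hS
    exact .mvar (by rw [List.getElem?_append_left (List.getElem?_eq_some_iff.mp h).1, h])

mutual
theorem Conv.sig_mono {S Ξ : Sig} (hS : S <+: Ξ) : ∀ {Γ : Ctx} {t u A : Tm},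
    Conv S Γ t u A → Conv Ξ Γ t u A
  | _, _, _, _, .univ => .univ
  | _, _, _, _, .bool => .bool
  | _, _, _, _, .tru => .tru
  | _, _, _, _, .fls => .fls
  | _, _, _, _, .pi h₁ h₂ => .pi (Conv.sig_mono hS h₁) (Conv.sig_mono hS h₂)
  | _, _, _, _, .eta hf hg h => .eta hf hg (Conv.sig_mono hS h)
  | _, _, _, _, .neu h₁ h₂ => .neu (ConvNe.sig_mono hS h₁) (Conv.sig_mono hS h₂)
theorem ConvNe.sig_mono {S Ξ : Sig} (hS : S <+: Ξ) : ∀ {Γ : Ctx} {n n' : Ne} {A : Tm},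
    ConvNe S Γ n n' A → ConvNe Ξ Γ n n' A
  | _, _, _, _, .head h => .head (h.sig_mono hS)
  | _, _, _, _, .app h₁ h₂ h₃ => .app (ConvNe.sig_mono hS h₁) (Conv.sig_mono hS h₂) h₃
  | _, _, _, _, .ite h₁ h₂ h₃ h₄ h₅ h₆ h₇ =>
    .ite (ConvNe.sig_mono hS h₁) (Conv.sig_mono hS h₂) h₃ (Conv.sig_mono hS h₄) h₅
      (Conv.sig_mono hS h₆) h₇
end

mutual
theorem HasTy.sig_mono {S Ξ : Sig} (hS : S <+: Ξ) : ∀ {Γ : Ctx} {t A : Tm},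
    HasTy S Γ t A → HasTy Ξ Γ t A
  | _, _, _, .univ => .univ
  | _, _, _, .bool => .bool
  | _, _, _, .tru => .tru
  | _, _, _, .fls => .fls
  | _, _, _, .pi h₁ h₂ => .pi (HasTy.sig_mono hS h₁) (HasTy.sig_mono hS h₂)
  | _, _, _, .lam h => .lam (HasTy.sig_mono hS h)
  | _, _, _, .neu h₁ h₂ => .neu (NeTy.sig_mono hS h₁) (h₂.sig_mono hS)
theorem NeTy.sig_mono {S Ξ : Sig} (hS : S <+: Ξ) : ∀ {Γ : Ctx} {n : Ne} {A : Tm},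
    NeTy S Γ n A → NeTy Ξ Γ n A
  | _, _, _, .head h => .head (h.sig_mono hS)
  | _, _, _, .app h₁ h₂ h₃ => .app (NeTy.sig_mono hS h₁) (HasTy.sig_mono hS h₂) h₃
  | _, _, _, .ite h₁ h₂ h₃ h₄ h₅ h₆ h₇ =>
    .ite (NeTy.sig_mono hS h₁) (HasTy.sig_mono hS h₂) h₃ (HasTy.sig_mono hS h₄) h₅
      (HasTy.sig_mono hS h₆) h₇
end

theorem CtxWF.sig_mono {S Ξ : Sig} (hS : S <+: Ξ) {Γ : Ctx} (h : CtxWF S Γ) : CtxWF Ξ Γ := by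
  induction h with
  | nil => exact .nil
  | cons _ hA ih => exact .cons ih (hA.sig_mono hS)

theorem ConstraintsWF.sig_mono {S Ξ : Sig} (hS : S <+: Ξ) {Γ : Ctx} {C : Set Constraint}
    (h : ConstraintsWF S Γ C) : ConstraintsWF Ξ Γ C := fun c hc =>
  ⟨(h c hc).1, (h c hc).2.ctx_wf.sig_mono hS, (h c hc).2.lhs_ty.sig_mono hS,
    (h c hc).2.rhs_ty.sig_mono hS⟩

theorem ConstraintsWF.of_cons {S : Sig} {Γ : Ctx} {A : Tm} {C : Set Constraint}
    (h : ConstraintsWF S (A :: Γ) C) : ConstraintsWF S Γ C := fun c hc =>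
  ⟨(List.suffix_cons A Γ).trans (h c hc).1, (h c hc).2⟩

theorem ConstraintsWF.empty (S : Sig) (Γ : Ctx) : ConstraintsWF S Γ ∅ := fun _ hc => hc.elim

theorem ConstraintsWF.union {S : Sig} {Γ : Ctx} {C D : Set Constraint}
    (hC : ConstraintsWF S Γ C) (hD : ConstraintsWF S Γ D) : ConstraintsWF S Γ (C ∪ D) :=
  fun c hc => hc.elim (hC c) (hD c)

/-! ### Scoping of typed terms -/

theorem HeadTy.scoped {S : Sig} {Γ : Ctx} {h : Head} {A : Tm} (hh : HeadTy S Γ h A) :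
    h.Scoped S.length Γ.length := by
  cases hh with
  | var h => exact (List.getElem?_eq_some_iff.mp h).1
  | mvar h => exact (List.getElem?_eq_some_iff.mp h).1

mutual
theorem HasTy.scoped {S : Sig} : ∀ {Γ : Ctx} {t A : Tm}, HasTy S Γ t A →
    t.Scoped S.length Γ.length
  | _, _, _, .univ | _, _, _, .bool | _, _, _, .tru | _, _, _, .fls => by simp [Tm.Scoped]
  | _, _, _, .pi h₁ h₂ => by
    simp only [Tm.Scoped]; exact ⟨HasTy.scoped h₁, HasTy.scoped h₂⟩
  | _, _, _, .lam h => by simp only [Tm.Scoped]; exact HasTy.scoped h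
  | _, _, _, .neu h _ => by simp only [Tm.Scoped]; exact NeTy.scoped h
theorem NeTy.scoped {S : Sig} : ∀ {Γ : Ctx} {n : Ne} {A : Tm}, NeTy S Γ n A →
    n.Scoped S.length Γ.length
  | _, _, _, .head h => by simp only [Ne.Scoped]; exact h.scoped
  | _, _, _, .app h₁ h₂ _ => by
    simp only [Ne.Scoped]; exact ⟨NeTy.scoped h₁, HasTy.scoped h₂⟩
  | _, _, _, .ite h₁ h₂ _ h₄ _ h₆ _ => by
    simp only [Ne.Scoped]
    exact ⟨NeTy.scoped h₁, HasTy.scoped h₂, HasTy.scoped h₄, HasTy.scoped h₆⟩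
end

theorem SigWF.getElem {S : Sig} (hS : SigWF S) {α : ℕ} {A : Tm} (h : S[α]? = some A) :
    HasTy S [] A .univ := by
  induction hS with
  | nil => simp at h
  | @snoc S B hS hB ih =>
    have hp : S <+: S ++ [B] := List.prefix_append S [B]
    rcases lt_trichotomy α S.length with hα | rfl | hα
    · rw [List.getElem?_append_left hα] at h
      exact (ih h).sig_mono hp
    · simp at h
      exact h ▸ hB.sig_mono hp
    · rw [List.getElem?_eq_none (by simp; omega)] at h
      cases h

theorem SigWF.rename_getElem {S : Sig} (hS : SigWF S) {α : ℕ} {A : Tm} (h : S[α]? = some A)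
    (ρ : ℕ → ℕ) : A.rename ρ = A :=
  Tm.rename_of_scoped A (hS.getElem h).scoped (fun _ hi => absurd hi (Nat.not_lt_zero _))

/-! ### Weakening of contexts -/

/-- `ρ` maps the variables of `Γ` to variables of `Δ` of the same type. -/
def IsRenaming (ρ : ℕ → ℕ) (Γ Δ : Ctx) : Prop :=
  ∀ i A, Γ[i]? = some A → ∃ B, Δ[ρ i]? = some B ∧
    B.rename (fun j => j + (ρ i + 1)) = (A.rename (fun j => j + (i + 1))).rename ρ

theorem IsRenaming.lift {ρ : ℕ → ℕ} {Γ Δ : Ctx} (h : IsRenaming ρ Γ Δ) (A : Tm) :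
    IsRenaming (lift ρ) (A :: Γ) (A.rename ρ :: Δ) := by
  intro i B hB
  cases i with
  | zero =>
    simp only [List.getElem?_cons_zero, Option.some.injEq] at hB
    subst hB
    refine ⟨A.rename ρ, rfl, ?_⟩
    simp only [Tm.rename_rename]; rfl
  | succ i =>
    obtain ⟨D, hD, e⟩ := h i B hB
    refine ⟨D, hD, ?_⟩
    have e' := congrArg Tm.shift e
    simp only [Tm.shift, Tm.rename_rename] at e' ⊢
    exact e'

theorem isRenaming_nil (ρ : ℕ → ℕ) (Δ : Ctx) : IsRenaming ρ [] Δ := by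
  intro i A h; simp at h

theorem isRenaming_succ (A : Tm) (Γ : Ctx) : IsRenaming Nat.succ Γ (A :: Γ) := by
  intro i B hB
  refine ⟨B, hB, ?_⟩
  simp only [Tm.rename_rename]; rfl

theorem HeadTy.rename {S : Sig} (hS : SigWF S) {ρ : ℕ → ℕ} {Γ Δ : Ctx} (hρ : IsRenaming ρ Γ Δ)
    {h : Head} {A : Tm} (hh : HeadTy S Γ h A) : HeadTy S Δ (h.rename ρ) (A.rename ρ) := by
  cases hh with
  | var h =>
    obtain ⟨B, hB, e⟩ := hρ _ _ h
    rw [← e]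
    exact .var hB
  | mvar h =>
    rw [hS.rename_getElem h]
    exact .mvar h

mutual
-- Well-formedness of the signature makes the types of meta-variables closed, hence fixed by `ρ`.
-- Substitution and elimination premises are transported by their own renaming lemmas.
theorem Conv.rename {S : Sig} (hS : SigWF S) : ∀ {ρ : ℕ → ℕ} {Γ Δ : Ctx} {t u A : Tm},
    IsRenaming ρ Γ Δ → Conv S Γ t u A → Conv S Δ (t.rename ρ) (u.rename ρ) (A.rename ρ)
  | _, _, _, _, _, _, _, .univ => by simp only [Tm.rename]; exact .univ
  | _, _, _, _, _, _, _, .bool => by simp only [Tm.rename]; exact .bool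
  | _, _, _, _, _, _, _, .tru => by simp only [Tm.rename]; exact .tru
  | _, _, _, _, _, _, _, .fls => by simp only [Tm.rename]; exact .fls
  | _, _, _, _, _, _, hρ, .pi h₁ h₂ => by
    have k₁ := Conv.rename hS hρ h₁
    have k₂ := Conv.rename hS (hρ.lift _) h₂
    simp only [Tm.rename] at k₁ k₂ ⊢
    exact .pi k₁ k₂
  | ρ, _, _, _, _, _, hρ, .eta hf hg h => by
    have kf := hf.rename (Elab.lift ρ)
    have kg := hg.rename (Elab.lift ρ)
    rw [Tm.shift_rename] at kf kg
    simp only [Tm.rename]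
    exact .eta kf kg (Conv.rename hS (hρ.lift _) h)
  | _, _, _, _, _, _, hρ, .neu h₁ h₂ => by
    have k₂ := Conv.rename hS hρ h₂
    simp only [Tm.rename] at k₂ ⊢
    exact .neu (ConvNe.rename hS hρ h₁) k₂
theorem ConvNe.rename {S : Sig} (hS : SigWF S) : ∀ {ρ : ℕ → ℕ} {Γ Δ : Ctx} {n n' : Ne} {A : Tm},
    IsRenaming ρ Γ Δ → ConvNe S Γ n n' A → ConvNe S Δ (n.rename ρ) (n'.rename ρ) (A.rename ρ)
  | _, _, _, _, _, _, hρ, .head h => by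
    simp only [Ne.rename]; exact .head (h.rename hS hρ)
  | ρ, _, _, _, _, _, hρ, .app h₁ h₂ h₃ => by
    have k₁ := ConvNe.rename hS hρ h₁
    simp only [Tm.rename, Ne.rename] at k₁ ⊢
    exact .app k₁ (Conv.rename hS hρ h₂) (h₃.rename ρ)
  | ρ, _, _, _, _, _, hρ, .ite h₁ h₂ h₃ h₄ h₅ h₆ h₇ => by
    have k₁ := ConvNe.rename hS hρ h₁
    have k₂ := Conv.rename hS (hρ.lift _) h₂
    have k₃ := h₃.rename ρ
    have k₅ := h₅.rename ρ
    have k₇ := h₇.rename ρ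
    simp only [Tm.rename, Ne.rename] at k₁ k₂ k₃ k₅ k₇ ⊢
    exact .ite k₁ k₂ k₃ (Conv.rename hS hρ h₄) k₅ (Conv.rename hS hρ h₆) k₇
end

mutual
theorem HasTy.rename {S : Sig} (hS : SigWF S) : ∀ {ρ : ℕ → ℕ} {Γ Δ : Ctx} {t A : Tm},
    IsRenaming ρ Γ Δ → HasTy S Γ t A → HasTy S Δ (t.rename ρ) (A.rename ρ)
  | _, _, _, _, _, _, .univ => by simp only [Tm.rename]; exact .univ
  | _, _, _, _, _, _, .bool => by simp only [Tm.rename]; exact .bool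
  | _, _, _, _, _, _, .tru => by simp only [Tm.rename]; exact .tru
  | _, _, _, _, _, _, .fls => by simp only [Tm.rename]; exact .fls
  | _, _, _, _, _, hρ, .pi h₁ h₂ => by
    have k₁ := HasTy.rename hS hρ h₁
    have k₂ := HasTy.rename hS (hρ.lift _) h₂
    simp only [Tm.rename] at k₁ k₂ ⊢
    exact .pi k₁ k₂
  | _, _, _, _, _, hρ, .lam h => by
    simp only [Tm.rename]
    exact .lam (HasTy.rename hS (hρ.lift _) h)
  | _, _, _, _, _, hρ, .neu h₁ h₂ => by
    have k₂ := h₂.rename hS hρ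
    simp only [Tm.rename] at k₂ ⊢
    exact .neu (NeTy.rename hS hρ h₁) k₂
theorem NeTy.rename {S : Sig} (hS : SigWF S) : ∀ {ρ : ℕ → ℕ} {Γ Δ : Ctx} {n : Ne} {A : Tm},
    IsRenaming ρ Γ Δ → NeTy S Γ n A → NeTy S Δ (n.rename ρ) (A.rename ρ)
  | _, _, _, _, _, hρ, .head h => by
    simp only [Ne.rename]; exact .head (h.rename hS hρ)
  | ρ, _, _, _, _, hρ, .app h₁ h₂ h₃ => by
    have k₁ := NeTy.rename hS hρ h₁
    simp only [Tm.rename, Ne.rename] at k₁ ⊢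
    exact .app k₁ (HasTy.rename hS hρ h₂) (h₃.rename ρ)
  | ρ, _, _, _, _, hρ, .ite h₁ h₂ h₃ h₄ h₅ h₆ h₇ => by
    have k₁ := NeTy.rename hS hρ h₁
    have k₂ := HasTy.rename hS (hρ.lift _) h₂
    have k₃ := h₃.rename ρ
    have k₅ := h₅.rename ρ
    have k₇ := h₇.rename ρ
    simp only [Tm.rename, Ne.rename] at k₁ k₂ k₃ k₅ k₇ ⊢
    exact .ite k₁ k₂ k₃ (HasTy.rename hS hρ h₄) k₅ (HasTy.rename hS hρ h₆) k₇
end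

theorem HasTy.shift_univ {S : Sig} (hS : SigWF S) {Γ : Ctx} {A : Tm} (B : Tm)
    (h : HasTy S Γ A .univ) : HasTy S (B :: Γ) A.shift .univ := by
  have h' := h.rename hS (isRenaming_succ B Γ)
  simpa only [Tm.rename, Tm.shift] using h'

/-! ### Reflexivity of definitional equality -/

mutual
-- Typing and equality rules match one to one, except that abstractions are compared by η: applying
-- the weakened abstraction to the new variable returns its body.
theorem HasTy.conv_refl {S : Sig} : ∀ {Γ : Ctx} {t A : Tm}, HasTy S Γ t A → Conv S Γ t t A
  | _, _, _, .univ => .univ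
  | _, _, _, .bool => .bool
  | _, _, _, .tru => .tru
  | _, _, _, .fls => .fls
  | _, _, _, .pi h₁ h₂ => .pi (HasTy.conv_refl h₁) (HasTy.conv_refl h₂)
  | _, _, _, .lam (t := t) h => by
    have ht : AppElim (Tm.lam t).shift (.var 0) t := by
      simp only [Tm.shift, Tm.rename]; exact .lam (Subst.var_zero t)
    exact .eta ht ht (HasTy.conv_refl h)
  | _, _, _, .neu h₁ h₂ => .neu (NeTy.conv_refl h₁) h₂
theorem NeTy.conv_refl {S : Sig} : ∀ {Γ : Ctx} {n : Ne} {A : Tm}, NeTy S Γ n A →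
    ConvNe S Γ n n A
  | _, _, _, .head h => .head h
  | _, _, _, .app h₁ h₂ h₃ => .app (NeTy.conv_refl h₁) (HasTy.conv_refl h₂) h₃
  | _, _, _, .ite h₁ h₂ h₃ h₄ h₅ h₆ h₇ =>
    .ite (NeTy.conv_refl h₁) (HasTy.conv_refl h₂) h₃ (HasTy.conv_refl h₄) h₅
      (HasTy.conv_refl h₆) h₇
end

theorem NeTy.hasTy {S : Sig} {Γ : Ctx} {n : Ne} {A : Tm} (h : NeTy S Γ n A)
    (hA : HasTy S Γ A .univ) : HasTy S Γ (.neu n) A :=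
  .neu h hA.conv_refl

theorem HeadTy.type_wf {S : Sig} (hS : SigWF S) {Γ : Ctx} (hΓ : CtxWF S Γ) {h : Head} {A : Tm}
    (hh : HeadTy S Γ h A) : HasTy S Γ A .univ := by
  cases hh with
  | @var i A hA =>
    induction hΓ generalizing i A with
    | nil => simp at hA
    | @cons Γ B _ hB ih =>
      cases i with
      | zero =>
        simp only [List.getElem?_cons_zero, Option.some.injEq] at hA
        exact hA ▸ hB.shift_univ hS B
      | succ i =>
        have h := (ih hA).shift_univ hS B
        rw [Tm.shift, Tm.rename_rename] at h
        exact h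
  | mvar hA =>
    have h := (hS.getElem hA).rename hS (isRenaming_nil id Γ)
    rw [Tm.rename_id] at h
    simpa only [Tm.rename] using h

/-! ### Fresh meta-variables -/

/-- The neutral term `Sig.freshTm S Γ`. -/
def Sig.freshNe (S : Sig) (Γ : Ctx) : Ne := Ne.appVars (.head (.mvar S.length)) Γ.length

theorem Sig.prefix_fresh (S : Sig) (Γ : Ctx) (A : Tm) : S <+: S.fresh Γ A :=
  List.prefix_append _ _

/-- The definition supplies the oldest variable first, whereas induction on a context needs the
newest one split off at the outside. -/
theorem Ne.appVars_succ (n : Ne) (k : ℕ) :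
    (n.rename Nat.succ).appVars (k + 1) = .app ((n.appVars k).rename Nat.succ) (.var 0) := by
  induction k generalizing n with
  | zero => rfl
  | succ k ih =>
    have h := ih (.app n (.var k))
    simp only [Ne.rename, Tm.rename, Tm.var, Head.rename] at h
    exact h

theorem Sig.freshNe_cons (S : Sig) (Γ : Ctx) (B : Tm) :
    S.freshNe (B :: Γ) = .app ((S.freshNe Γ).rename Nat.succ) (.var 0) := by
  have h := Ne.appVars_succ (.head (.mvar S.length)) Γ.length
  simp only [Ne.rename, Head.rename] at h
  exact h

/-- The bound variable occurs only as the last argument of the fresh term; everything before it is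
weakened. -/
theorem Sig.subst_freshTm_cons (S : Sig) (Γ : Ctx) (B v : Tm) :
    Subst 0 v (S.freshTm (B :: Γ)) (.neu (.app (S.freshNe Γ) v)) := by
  change Subst 0 v (.neu (S.freshNe (B :: Γ))) _
  rw [Sig.freshNe_cons]
  exact .neu (.app (.rename_succ v _) (.neu .var_eq) .neu)

theorem HasTy.arrow {S : Sig} {Γ : Ctx} (hΓ : CtxWF S Γ) {A : Tm} (hA : HasTy S Γ A .univ) :
    HasTy S [] (Γ.arrow A) .univ := by
  induction hΓ generalizing A with
  | nil => exact hA
  | cons _ hB ih => exact ih (.pi hB hA)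

theorem SigWF.fresh {S : Sig} (hS : SigWF S) {Γ : Ctx} (hΓ : CtxWF S Γ) {A : Tm}
    (hA : HasTy S Γ A .univ) : SigWF (S.fresh Γ A) :=
  .snoc hS (.arrow hΓ hA)

theorem NeTy.appVars {S : Sig} (hS : SigWF S) {α : ℕ} {Γ : Ctx} (hΓ : CtxWF S Γ) {A : Tm}
    (hα : S[α]? = some (Γ.arrow A)) :
    NeTy S Γ (Ne.appVars (.head (.mvar α)) Γ.length) A := by
  induction hΓ generalizing A with
  | nil => exact .head (.mvar hα)
  | @cons Γ B hΓ hB ih =>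
    -- By definition `Ctx.arrow (B :: Γ) A` is `Ctx.arrow Γ (.pi B A)`, so the same meta-variable is
    -- a function over the shorter context.
    have h := (ih (A := .pi B A) hα).rename hS (isRenaming_succ B Γ)
    have e := Ne.appVars_succ (.head (.mvar α)) Γ.length
    simp only [Ne.rename, Head.rename] at e
    rw [List.length_cons, e]
    simp only [Tm.rename] at h
    refine .app h ?_ (Subst.var_zero A)
    exact NeTy.hasTy (.head (.var (i := 0) rfl)) (hB.shift_univ hS B)

theorem Sig.freshNe_ty {S : Sig} (hS : SigWF S) {Γ : Ctx} (hΓ : CtxWF S Γ) {A : Tm}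
    (hA : HasTy S Γ A .univ) : NeTy (S.fresh Γ A) Γ (S.freshNe Γ) A :=
  .appVars (hS.fresh hΓ hA) (hΓ.sig_mono (S.prefix_fresh Γ A)) (by simp [Sig.fresh])

theorem Sig.freshTm_ty {S : Sig} (hS : SigWF S) {Γ : Ctx} (hΓ : CtxWF S Γ) {A : Tm}
    (hA : HasTy S Γ A .univ) : HasTy (S.fresh Γ A) Γ (S.freshTm Γ) A :=
  (Sig.freshNe_ty hS hΓ hA).hasTy (hA.sig_mono (S.prefix_fresh Γ A))

/-- A fresh type in a context with one more variable is a fresh type family. -/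
theorem Sig.freshNe_ty_family {S : Sig} (hS : SigWF S) {Γ : Ctx} (hΓ : CtxWF S Γ) {B : Tm}
    (hB : HasTy S Γ B .univ) :
    NeTy (S.fresh (B :: Γ) .univ) Γ (S.freshNe Γ) (.pi B .univ) :=
  Sig.freshNe_ty hS hΓ (.pi hB .univ)

/-- The codomain is the constant `Set`, which any substitution fixes. -/
theorem NeTy.app_family {S : Sig} {Γ : Ctx} {n : Ne} {B v : Tm} (hn : NeTy S Γ n (.pi B .univ))
    (hv : HasTy S Γ v B) : HasTy S Γ (.neu (.app n v)) .univ :=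
  NeTy.hasTy (.app hn hv .univ) .univ

/-! ### Functionality of elaboration -/

theorem HeadTy.functional {S : Sig} {Γ : Ctx} {h : Head} {A B : Tm} (hA : HeadTy S Γ h A)
    (hB : HeadTy S Γ h B) : B = A := by
  cases hA <;> cases hB <;> simp_all

/-- Inference for `t` has at most one result. -/
def InferFunctional (t : Tm) : Prop :=
  ∀ ⦃S : Sig⦄ ⦃Γ : Ctx⦄ ⦃Ξ Ξ' : Sig⦄ ⦃C C' : Set Constraint⦄ ⦃u u' A A' : Tm⦄,
    Infer S Γ t Ξ C u A → Infer S Γ t Ξ' C' u' A' → Ξ' = Ξ ∧ C' = C ∧ u' = u ∧ A' = A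

theorem InferFunctional.check {t : Tm} (ht : InferFunctional t) {S : Sig} {Γ : Ctx} {A : Tm}
    {Ξ Ξ' : Sig} {C C' : Set Constraint} {u u' : Tm}
    (h : Check S Γ t A Ξ C u) (h' : Check S Γ t A Ξ' C' u') : Ξ' = Ξ ∧ C' = C ∧ u' = u := by
  cases h with
  | intro h =>
    cases h' with
    | intro h' =>
      obtain ⟨rfl, rfl, rfl, rfl⟩ := ht h h'
      exact ⟨rfl, rfl, rfl⟩

mutual
-- Signature and context are universally quantified in the induction hypothesis, as later premises
-- run in outputs of earlier ones. Each premise's outputs are identified before the next is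
-- compared.
theorem Infer.functional : ∀ t : Tm, InferFunctional t
  | .univ | .bool | .tru | .fls => by
    intro S Γ Ξ Ξ' C C' u u' A A' h h'
    cases h; cases h'; exact ⟨rfl, rfl, rfl, rfl⟩
  | .pi A B => by
    intro S Γ Ξ Ξ' C C' u u' T T' h h'
    cases h with
    | pi hA hB =>
    cases h' with
    | pi hA' hB' =>
    obtain ⟨rfl, rfl, rfl⟩ := (Infer.functional A).check hA hA'
    obtain ⟨rfl, rfl, rfl⟩ := (Infer.functional B).check hB hB'
    exact ⟨rfl, rfl, rfl, rfl⟩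
  | .lam t => by
    intro S Γ Ξ Ξ' C C' u u' T T' h h'
    cases h with
    | lam e₁ e₂ e₃ e₄ ht =>
    cases h' with
    | lam e₁' e₂' e₃' e₄' ht' =>
    subst e₁ e₂ e₃ e₄ e₁' e₂' e₃' e₄'
    obtain ⟨rfl, rfl, rfl⟩ := (Infer.functional t).check ht ht'
    exact ⟨rfl, rfl, rfl, rfl⟩
  | .neu n => Infer.functional_neu n
theorem Infer.functional_neu : ∀ n : Ne, InferFunctional (.neu n)
  | .head _ => by
    intro S Γ Ξ Ξ' C C' u u' A A' h h'
    cases h with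
    | head h =>
    cases h' with
    | head h' => exact ⟨rfl, rfl, rfl, h.functional h'⟩
  | .app n t => by
    intro S Γ Ξ Ξ' C C' u u' T T' h h'
    cases h with
    | app e₁ e₂ e₃ e₄ hn ht hw hT =>
    cases h' with
    | app e₁' e₂' e₃' e₄' hn' ht' hw' hT' =>
    subst e₁ e₂ e₃ e₄ e₁' e₂' e₃' e₄'
    obtain ⟨rfl, rfl, rfl⟩ := (Infer.functional_neu n).check hn hn'
    obtain ⟨rfl, rfl, rfl⟩ := (Infer.functional t).check ht ht'
    exact ⟨rfl, rfl, hw.functional hw', hT.functional hT'⟩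
  | .ite n B t s => by
    intro S Γ Ξ Ξ' C C' u u' T T' h h'
    cases h with
    | ite hB hn hBt ht hBf hs hw hT =>
    cases h' with
    | ite hB' hn' hBt' ht' hBf' hs' hw' hT' =>
    obtain ⟨rfl, rfl, rfl⟩ := (Infer.functional B).check hB hB'
    obtain ⟨rfl, rfl, rfl⟩ := (Infer.functional_neu n).check hn hn'
    obtain rfl := hBt.functional hBt'
    obtain ⟨rfl, rfl, rfl⟩ := (Infer.functional t).check ht ht'
    obtain rfl := hBf.functional hBf'
    obtain ⟨rfl, rfl, rfl⟩ := (Infer.functional s).check hs hs'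
    exact ⟨rfl, rfl, hw.functional hw', hT.functional hT'⟩
end

/-! ### Existence and well-formedness of elaboration -/

/-- Inference for `t` has a well-formed result whenever `t` is well scoped. -/
def InferTotal (t : Tm) : Prop :=
  ∀ ⦃S : Sig⦄ ⦃Γ : Ctx⦄, SigWF S → CtxWF S Γ → t.Scoped S.length Γ.length →
    ∃ (Ξ : Sig) (C : Set Constraint) (t' A : Tm), Infer S Γ t Ξ C t' A ∧ HasTy Ξ Γ A .univ ∧
      S <+: Ξ ∧ SigWF Ξ ∧ HasTy Ξ Γ t' A ∧ ConstraintsWF Ξ Γ C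

/-- Checking yields a fresh neutral term, whose inferred type is the given one. -/
theorem InferTotal.check {t : Tm} (ht : InferTotal t) {S : Sig} {Γ : Ctx} {A : Tm}
    (hS : SigWF S) (hΓ : CtxWF S Γ) (hs : t.Scoped S.length Γ.length)
    (hA : HasTy S Γ A .univ) :
    ∃ (Ξ : Sig) (C : Set Constraint), Check S Γ t A (Ξ.fresh Γ A) C (Ξ.freshTm Γ) ∧
      S <+: Ξ ∧ SigWF Ξ ∧ ConstraintsWF (Ξ.fresh Γ A) Γ C := by
  -- That `B` is a type is not needed: a constraint only asks for its two sides to be typed, and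
  -- their types may be unrelated.
  obtain ⟨Ξ, C, u, B, h, -, hp, hΞ, hu, hC⟩ := ht hS hΓ hs
  have hp' := Ξ.prefix_fresh Γ A
  refine ⟨Ξ, _, .intro h, hp, hΞ, ConstraintsWF.union ?_ (hC.sig_mono hp')⟩
  rintro c rfl
  exact ⟨List.suffix_refl Γ, hΓ.sig_mono (hp.trans hp'), hu.sig_mono hp',
    Sig.freshTm_ty hΞ (hΓ.sig_mono hp) (hA.sig_mono hp)⟩

theorem Tm.Scoped.of_prefix {S Ξ : Sig} (h : S <+: Ξ) {k : ℕ} {t : Tm}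
    (ht : t.Scoped S.length k) : t.Scoped Ξ.length k :=
  Tm.Scoped.mono h.length_le t ht

mutual
theorem Infer.total : ∀ t : Tm, InferTotal t
  | .univ => fun S Γ hS _ _ =>
    ⟨S, ∅, .univ, .univ, .univ, .univ, List.prefix_refl S, hS, .univ, .empty S Γ⟩
  | .bool => fun S Γ hS _ _ =>
    ⟨S, ∅, .bool, .univ, .bool, .univ, List.prefix_refl S, hS, .bool, .empty S Γ⟩
  | .tru => fun S Γ hS _ _ =>
    ⟨S, ∅, .tru, .bool, .tru, .bool, List.prefix_refl S, hS, .tru, .empty S Γ⟩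
  | .fls => fun S Γ hS _ _ =>
    ⟨S, ∅, .fls, .bool, .fls, .bool, List.prefix_refl S, hS, .fls, .empty S Γ⟩
  | .pi A B => by
    intro S Γ hS hΓ hs
    simp only [Tm.Scoped] at hs
    obtain ⟨Ξ₁, C₁, h₁, hp₁, hΞ₁, hC₁⟩ := (Infer.total A).check hS hΓ hs.1 .univ
    have hA := Sig.freshTm_ty hΞ₁ (hΓ.sig_mono hp₁) .univ
    have hp₁' := hp₁.trans (Ξ₁.prefix_fresh Γ .univ)
    have hΓ₁ := hΓ.sig_mono hp₁'
    have hS₁ := hΞ₁.fresh (hΓ.sig_mono hp₁) .univ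
    obtain ⟨Ξ₂, C₂, h₂, hp₂, hΞ₂, hC₂⟩ := (Infer.total B).check hS₁ (hΓ₁.cons hA)
      (hs.2.of_prefix hp₁') .univ
    have hΓ₂ := (hΓ₁.cons hA).sig_mono hp₂
    have hB := Sig.freshTm_ty hΞ₂ hΓ₂ .univ
    have hp₂' := hp₂.trans (Ξ₂.prefix_fresh (Ξ₁.freshTm Γ :: Γ) .univ)
    exact ⟨_, _, _, _, .pi h₁ h₂, .univ, hp₁'.trans hp₂', hΞ₂.fresh hΓ₂ .univ,
      .pi (hA.sig_mono hp₂') hB, (hC₁.sig_mono hp₂').union hC₂.of_cons⟩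
  | .lam t => by
    intro S Γ hS hΓ hs
    simp only [Tm.Scoped] at hs
    have hβ := Sig.freshTm_ty hS hΓ .univ
    have hp₁ := S.prefix_fresh Γ .univ
    have hS₁ := hS.fresh hΓ .univ
    have hΓ₁ := (hΓ.sig_mono hp₁).cons hβ
    have hγ := Sig.freshTm_ty hS₁ hΓ₁ .univ
    have hp₂ := (S.fresh Γ .univ).prefix_fresh (S.freshTm Γ :: Γ) .univ
    have hS₂ := hS₁.fresh hΓ₁ .univ
    have hΓ₂ := hΓ₁.sig_mono hp₂
    obtain ⟨Ξ, C, h, hp, hΞ, hC⟩ := (Infer.total t).check hS₂ hΓ₂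
      (hs.of_prefix (hp₁.trans hp₂)) hγ
    have hp' := hp.trans (Ξ.prefix_fresh (S.freshTm Γ :: Γ)
      ((S.fresh Γ .univ).freshTm (S.freshTm Γ :: Γ)))
    have hu := Sig.freshTm_ty hΞ (hΓ₂.sig_mono hp) (hγ.sig_mono hp)
    exact ⟨_, _, _, _, .lam rfl rfl rfl rfl h,
      .pi (hβ.sig_mono (hp₂.trans hp')) (hγ.sig_mono hp'), hp₁.trans (hp₂.trans hp'),
      hΞ.fresh (hΓ₂.sig_mono hp) (hγ.sig_mono hp), .lam hu, hC.of_cons⟩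
  | .neu n => Infer.total_neu n
theorem Infer.total_neu : ∀ n : Ne, InferTotal (.neu n)
  | .head h => by
    intro S Γ hS hΓ hs
    simp only [Tm.Scoped, Ne.Scoped] at hs
    -- Scoping does its work here: it makes the lookup of a head succeed.
    obtain ⟨A, hA⟩ : ∃ A, HeadTy S Γ h A := by
      cases h with
      | var i => exact ⟨_, .var (List.getElem?_eq_getElem hs)⟩
      | mvar α => exact ⟨_, .mvar (List.getElem?_eq_getElem hs)⟩
    have hA' := hA.type_wf hS hΓ
    exact ⟨S, ∅, _, A, .head hA, hA', List.prefix_refl S, hS, (NeTy.head hA).hasTy hA',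
      .empty S Γ⟩
  | .app n t => by
    intro S Γ hS hΓ hs
    simp only [Tm.Scoped, Ne.Scoped] at hs
    have hβ := Sig.freshTm_ty hS hΓ .univ
    have hp₁ := S.prefix_fresh Γ .univ
    have hS₁ := hS.fresh hΓ .univ
    have hΓ₁ := hΓ.sig_mono hp₁
    have hγ := Sig.freshTm_ty hS₁ (hΓ₁.cons hβ) .univ
    -- The meta-variable behind `γ` is used twice: as a type under the binder, to form `(x : β) →
    -- γ`, and as a family over `Γ`, to type the instance at the argument.
    have hγ' := Sig.freshNe_ty_family hS₁ hΓ₁ hβ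
    have hp₂ := (S.fresh Γ .univ).prefix_fresh (S.freshTm Γ :: Γ) .univ
    have hS₂ := hS₁.fresh (hΓ₁.cons hβ) .univ
    have hΓ₂ := hΓ₁.sig_mono hp₂
    have hβ₂ := hβ.sig_mono hp₂
    obtain ⟨Ξ₁, C₁, h₁, hp₃, hΞ₁, hC₁⟩ := (Infer.total_neu n).check hS₂ hΓ₂
      (Tm.Scoped.of_prefix (t := .neu n) (hp₁.trans hp₂) (by simpa only [Tm.Scoped] using hs.1))
      (hβ₂.pi hγ)
    have hΓ₃ := hΓ₂.sig_mono hp₃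
    have hβγ := (hβ₂.pi hγ).sig_mono hp₃
    have hn := Sig.freshNe_ty hΞ₁ hΓ₃ hβγ
    have hS₃ := hΞ₁.fresh hΓ₃ hβγ
    have hp₃' := hp₃.trans (Ξ₁.prefix_fresh Γ
      (.pi (S.freshTm Γ) ((S.fresh Γ .univ).freshTm (S.freshTm Γ :: Γ))))
    obtain ⟨Ξ₂, C₂, h₂, hp₄, hΞ₂, hC₂⟩ := (Infer.total t).check hS₃ (hΓ₂.sig_mono hp₃')
      (hs.2.of_prefix (hp₁.trans (hp₂.trans hp₃'))) (hβ₂.sig_mono hp₃')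
    have hΓ₄ := hΓ₂.sig_mono (hp₃'.trans hp₄)
    have hβ₄ := hβ₂.sig_mono (hp₃'.trans hp₄)
    have hv := Sig.freshTm_ty hΞ₂ hΓ₄ hβ₄
    have hp₄' := hp₄.trans (Ξ₂.prefix_fresh Γ (S.freshTm Γ))
    have hT := (hγ'.sig_mono (hp₃'.trans hp₄')).app_family hv
    have hsub := (S.fresh Γ .univ).subst_freshTm_cons Γ (S.freshTm Γ) (Ξ₂.freshTm Γ)
    exact ⟨_, _, _, _, .app rfl rfl rfl rfl h₁ h₂ .neu hsub, hT,
      hp₁.trans (hp₂.trans (hp₃'.trans hp₄')), hΞ₂.fresh hΓ₄ hβ₄,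
      NeTy.hasTy (.app (hn.sig_mono hp₄') hv hsub) hT, (hC₁.sig_mono hp₄').union hC₂⟩
  | .ite n B t s => by
    intro S Γ hS hΓ hs
    simp only [Tm.Scoped, Ne.Scoped] at hs
    obtain ⟨Ξ₁, C₁, h₁, hp₁, hΞ₁, hC₁⟩ := (Infer.total B).check hS (hΓ.cons .bool) hs.2.1 .univ
    have hΓ₁ := hΓ.sig_mono hp₁
    have hB := Sig.freshTm_ty hΞ₁ (hΓ₁.cons .bool) .univ
    have hB' := Sig.freshNe_ty_family hΞ₁ hΓ₁ .bool
    have hS₁ := hΞ₁.fresh (hΓ₁.cons .bool) .univ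
    have hq₁ := Ξ₁.prefix_fresh (.bool :: Γ) .univ
    have hr₁ := hp₁.trans hq₁
    obtain ⟨Ξ₂, C₂, h₂, hp₂, hΞ₂, hC₂⟩ := (Infer.total_neu n).check hS₁ (hΓ.sig_mono hr₁)
      (Tm.Scoped.of_prefix (t := .neu n) hr₁ (by simpa only [Tm.Scoped] using hs.1)) .bool
    have hΓ₂ := hΓ.sig_mono (hr₁.trans hp₂)
    have hn := Sig.freshNe_ty hΞ₂ hΓ₂ .bool
    have hS₂ := hΞ₂.fresh hΓ₂ .bool
    have hq₂ := hp₂.trans (Ξ₂.prefix_fresh Γ .bool)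
    have hr₂ := hr₁.trans hq₂
    -- The motive is a fresh family, so one computation serves its instances at `true`, at `false`
    -- and at the scrutinee.
    have sub := fun v => Ξ₁.subst_freshTm_cons Γ .bool v
    have hBt := (hB'.sig_mono hq₂).app_family .tru
    obtain ⟨Ξ₃, C₃, h₃, hp₃, hΞ₃, hC₃⟩ := (Infer.total t).check hS₂ (hΓ.sig_mono hr₂)
      (hs.2.2.1.of_prefix hr₂) hBt
    have hΓ₃ := hΓ.sig_mono (hr₂.trans hp₃)
    have hBt₃ := hBt.sig_mono hp₃
    have ht := Sig.freshTm_ty hΞ₃ hΓ₃ hBt₃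
    have hS₃ := hΞ₃.fresh hΓ₃ hBt₃
    have hq₃ := hp₃.trans (Ξ₃.prefix_fresh Γ (.neu (.app (Ξ₁.freshNe Γ) .tru)))
    have hr₃ := hr₂.trans hq₃
    have hBf := (hB'.sig_mono (hq₂.trans hq₃)).app_family .fls
    obtain ⟨Ξ₄, C₄, h₄, hp₄, hΞ₄, hC₄⟩ := (Infer.total s).check hS₃ (hΓ.sig_mono hr₃)
      (hs.2.2.2.of_prefix hr₃) hBf
    have hΓ₄ := hΓ.sig_mono (hr₃.trans hp₄)
    have hBf₄ := hBf.sig_mono hp₄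
    have hu := Sig.freshTm_ty hΞ₄ hΓ₄ hBf₄
    have hq₄ := hp₄.trans (Ξ₄.prefix_fresh Γ (.neu (.app (Ξ₁.freshNe Γ) .fls)))
    have hn₄ := hn.sig_mono (hq₃.trans hq₄)
    have hT := (hB'.sig_mono (hq₂.trans (hq₃.trans hq₄))).app_family (hn₄.hasTy .bool)
    refine ⟨_, _, _, _, .ite h₁ h₂ (sub _) h₃ (sub _) h₄ .neu (sub _), hT,
      hr₃.trans hq₄, hΞ₄.fresh hΓ₄ hBf₄, ?_, ?_⟩
    · exact NeTy.hasTy (.ite hn₄ (hB.sig_mono (hq₂.trans (hq₃.trans hq₄))) (sub _)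
        (ht.sig_mono hq₄) (sub _) hu (sub _)) hT
    · exact (((hC₁.of_cons.sig_mono (hq₂.trans (hq₃.trans hq₄))).union
        (hC₂.sig_mono (hq₃.trans hq₄))).union (hC₃.sig_mono hq₄)).union hC₄
end

end Elab

-- Assembling existence, uniqueness and well-formedness

theorem mainTheorem4 (S : Elab.Sig) (Γ : Elab.Ctx) (t : Elab.Tm)
    (hS : Elab.SigWF S) (hΓ : Elab.CtxWF S Γ) (ht : t.Scoped S.length Γ.length) :
    (∃ (Ξ : Elab.Sig) (C : Set Elab.Constraint) (t' A : Elab.Tm),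
      Elab.Infer S Γ t Ξ C t' A ∧
      (∀ (Ξ₂ : Elab.Sig) (C₂ : Set Elab.Constraint) (t₂ A₂ : Elab.Tm),
        Elab.Infer S Γ t Ξ₂ C₂ t₂ A₂ → Ξ₂ = Ξ ∧ C₂ = C ∧ t₂ = t' ∧ A₂ = A) ∧
      Elab.HasTy Ξ Γ A .univ ∧
      S <+: Ξ ∧ Elab.SigWF Ξ ∧ Elab.HasTy Ξ Γ t' A ∧ Elab.ConstraintsWF Ξ Γ C) ∧
    (∀ A : Elab.Tm, Elab.HasTy S Γ A .univ →
      ∃ (Ξ : Elab.Sig) (C : Set Elab.Constraint) (t' : Elab.Tm),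
        Elab.Check S Γ t A Ξ C t' ∧
        (∀ (Ξ₂ : Elab.Sig) (C₂ : Set Elab.Constraint) (t₂ : Elab.Tm),
          Elab.Check S Γ t A Ξ₂ C₂ t₂ → Ξ₂ = Ξ ∧ C₂ = C ∧ t₂ = t') ∧
        S <+: Ξ ∧ Elab.SigWF Ξ ∧ Elab.HasTy Ξ Γ t' A ∧ Elab.ConstraintsWF Ξ Γ C) := by
  have htot := Elab.Infer.total t
  refine ⟨?_, fun A hA => ?_⟩
  · obtain ⟨Ξ, C, t', A, h, hA, hp, hΞ, ht', hC⟩ := htot hS hΓ ht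
    exact ⟨Ξ, C, t', A, h, fun _ _ _ _ h' => Elab.Infer.functional t h h', hA, hp, hΞ, ht', hC⟩
  · obtain ⟨Ξ, C, h, hp, hΞ, hC⟩ := htot.check hS hΓ ht hA
    exact ⟨_, C, _, h, fun _ _ _ h' => (Elab.Infer.functional t).check h h',
      hp.trans (Ξ.prefix_fresh Γ A), hΞ.fresh (hΓ.sig_mono hp) (hA.sig_mono hp),
      Elab.Sig.freshTm_ty hΞ (hΓ.sig_mono hp) (hA.sig_mono hp), hC⟩
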